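/- Let $k\ge 0$ be an integer, let $A=\mathbb{Z}[x_1,\ldots,x_k]$, and let $B$ be a superreflexive (real or complex) Banach space, i.e. $B$ admits an equivalent norm that is both uniformly convex and uniformly smooth. Notation. For $m\ge 2$, $\mathrm{E}_m(A)\le\mathrm{SL}_m(A)$ is the subgroup generated by the elementary matrices $I_m+re_{i,j}$ ($i\ne j$, $r\in A$), and $S^{m*}(A^m)$ is the additive group of symmetric $m\times m$ matrices over $A$. The semidirect product $\mathrm{E}_2(A)\ltimes A^2$ is formed with respect to the action $W\cdot v=Wv$, and $\mathrm{E}_2(A)\ltimes S^{2*}(A^2)$ and $\mathrm{SL}_3(A)\ltimes S^{3*}(A^3)$ with respect to the action $W\cdot v=Wv\,{}^tW$. All groups are discrete. An isometric representation $\rho$ of a group $G$ in $B$ is a homomorphism from $G$ to the group of linear isometric bijections of $B$. For a normal subgroup $N\trianglelefteq G$, the pair $G\trianglerighteq N$ has relative property $(\mathrm{T}_B)$ if for every isometric representation $\rho$ of $G$ in $B$, the representation $\rho'$ induced by $\rho$ on the quotient Banach space $B/B^{\rho(N)}$, where $B^{\rho(N)}$ is the subspace of $\rho(N)$-invariant vectors,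 does not have almost invariant vectors; that is, it is not the case that for every $\varepsilon>0$ and every nonempty finite subset $S\subseteq G$ there is $\xi\in B/B^{\rho(N)}$ with $\max_{s\in S}\|\xi-\rho'(s)\xi\|<\varepsilon\|\xi\|$. For a subset $U\subseteq G$, the pair $G\supseteq U$ has relative property $(\mathrm{FF}_B)$ if for every isometric representation $\rho$ of $G$ in $B$, every quasi-$\rho$-cocycle, i.e. every map $b\colon G\to B$ with $\sup_{g,h\in G}\|b(gh)-b(g)-\rho(g)b(h)\|<\infty$, is bounded on $U$. Proposition 6.6. Suppose that the pairs $\mathrm{E}_2(A)\ltimes A^2\trianglerighteq A^2$ and $\mathrm{E}_2(A)\ltimes S^{2*}(A^2)\trianglerighteq S^{2*}(A^2)$ have relative property $(\mathrm{T}_B)$. Then the pair $\mathrm{SL}_3(A)\ltimes S^{3*}(A^3)\geqslant S^{3*}(A^3)$ has relative property $(\mathrm{FF}_B)$. -/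

import Mathlib

open scoped Matrix

noncomputable section

/-! ### Superreflexive Banach spaces -/

/-- A normed space is uniformly smooth if its modulus of smoothness
`sup {(‖x + y‖ + ‖x - y‖) / 2 - 1 | ‖x‖ = 1, ‖y‖ ≤ τ}` is `o(τ)` as `τ → 0`. -/
def IsUniformlySmooth (E : Type*) [NormedAddCommGroup E] : Prop :=
  ∀ ε : ℝ, 0 < ε → ∃ δ : ℝ, 0 < δ ∧ ∀ τ : ℝ, 0 < τ → τ ≤ δ →
    ∀ x y : E, ‖x‖ = 1 → ‖y‖ ≤ τ → (‖x + y‖ + ‖x - y‖) / 2 - 1 ≤ ε * τ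

/-- A Banach space is superreflexive if it carries an equivalent norm that is uniformly convex and
uniformly smooth; the renormed space is `E`, and `B ≃L[𝕜] E` is the identification. -/
def IsSuperreflexive.{u, v} (𝕜 : Type u) [RCLike 𝕜] (B : Type v)
    [NormedAddCommGroup B] [NormedSpace 𝕜 B] : Prop :=
  ∃ (E : Type v) (_ : NormedAddCommGroup E) (_ : NormedSpace 𝕜 E),
    UniformConvexSpace E ∧ IsUniformlySmooth E ∧ Nonempty (B ≃L[𝕜] E)

/-! ### Isometric representations, relative `(T_B)` and relative `(FF_B)` -/

section Representations

variable {𝕜 : Type*} [RCLike 𝕜] {G : Type*} [Group G]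

/-- `ρ` is an isometric representation. (Each `ρ g` is bijective since `G` is a group.) -/
def IsIsometricRep {V : Type*} [SeminormedAddCommGroup V] [NormedSpace 𝕜 V]
    (ρ : Representation 𝕜 G V) : Prop :=
  ∀ (g : G) (ξ : V), ‖ρ g ξ‖ = ‖ξ‖

/-- `ρ` has almost invariant vectors. Taking `1 ∈ S` shows that such a `ξ` must have nonzero norm,
so a representation on the zero space has none. -/
def HasAlmostInvariantVectors {V : Type*} [SeminormedAddCommGroup V] [NormedSpace 𝕜 V]
    (ρ : Representation 𝕜 G V) : Prop :=
  ∀ ε : ℝ, 0 < ε → ∀ S : Finset G, ∃ ξ : V, ∀ s ∈ S, ‖ξ - ρ s ξ‖ < ε * ‖ξ‖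

/-- The subspace `B^{ρ(N)}` of `ρ(N)`-invariant vectors. -/
abbrev invariantsOf {V : Type*} [AddCommGroup V] [Module 𝕜 V]
    (ρ : Representation 𝕜 G V) (N : Subgroup G) : Submodule 𝕜 V :=
  Representation.invariants (ρ.comp N.subtype)

/-- The representation `ρ'` induced by `ρ` on the quotient `B / B^{ρ(N)}`, for `N` normal. -/
def quotientRep {V : Type*} [AddCommGroup V] [Module 𝕜 V]
    (ρ : Representation 𝕜 G V) (N : Subgroup G) [N.Normal] :
    Representation 𝕜 G (V ⧸ invariantsOf ρ N) :=
  ρ.quotient (invariantsOf ρ N) (ρ.le_comap_invariants N)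

/-- `b` is a quasi-`ρ`-cocycle. -/
def IsQuasiCocycle {V : Type*} [SeminormedAddCommGroup V] [NormedSpace 𝕜 V]
    (ρ : Representation 𝕜 G V) (b : G → V) : Prop :=
  ∃ C : ℝ, ∀ g h : G, ‖b (g * h) - b g - ρ g (b h)‖ ≤ C

variable (𝕜) (B : Type*) [NormedAddCommGroup B] [NormedSpace 𝕜 B]

/-- The pair `G ⊵ N` has relative property `(T_B)`: for every isometric representation `ρ` of `G`
in `B`, the induced representation on `B / B^{ρ(N)}` (with the quotient norm) has no almost
invariant vectors. -/
def HasRelativeTB (N : Subgroup G) [N.Normal] : Prop :=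
  ∀ ρ : Representation 𝕜 G B, IsIsometricRep ρ → ¬ HasAlmostInvariantVectors (quotientRep ρ N)

/-- The pair `G ⊇ U` has relative property `(FF_B)`: for every isometric representation `ρ` of `G`
in `B`, every quasi-`ρ`-cocycle is bounded on `U`. -/
def HasRelativeFFB (U : Set G) : Prop :=
  ∀ ρ : Representation 𝕜 G B, IsIsometricRep ρ →
    ∀ b : G → B, IsQuasiCocycle ρ b → ∃ C : ℝ, ∀ u ∈ U, ‖b u‖ ≤ C

end Representations

/-! ### The groups -/

section Groups

variable (m : ℕ) (R : Type*) [CommRing R]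

/-- The elementary group `E_m(R)`, generated by the elementary matrices `I + r e_{ij}`, `i ≠ j`. -/
def elementaryGroup : Subgroup (Matrix.SpecialLinearGroup (Fin m) R) :=
  Subgroup.closure {g | ∃ (i j : Fin m) (hij : i ≠ j) (r : R),
    g = Matrix.SpecialLinearGroup.transvection hij r}

/-- The additive group `S^{m*}(R^m)` of symmetric `m × m` matrices. -/
def symMatrices : AddSubgroup (Matrix (Fin m) (Fin m) R) where
  carrier := {v | v.IsSymm}
  zero_mem' := Matrix.isSymm_zero
  add_mem' hv hw := Matrix.IsSymm.add hv hw
  neg_mem' hv := Matrix.IsSymm.neg hv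

/-- The natural action `v ↦ W v` of `SL_m(R)` on the additive group `R^m`. -/
def vecAction : Matrix.SpecialLinearGroup (Fin m) R →* MulAut (Multiplicative (Fin m → R)) where
  toFun W :=
    { toFun v := .ofAdd (W.1 *ᵥ v.toAdd)
      invFun v := .ofAdd ((W⁻¹).1 *ᵥ v.toAdd)
      left_inv v := by
        have h : (W⁻¹).1 * W.1 = 1 := by
          rw [← Matrix.SpecialLinearGroup.coe_mul, inv_mul_cancel, Matrix.SpecialLinearGroup.coe_one]
        simp only [toAdd_ofAdd, Matrix.mulVec_mulVec, h, Matrix.one_mulVec, ofAdd_toAdd]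
      right_inv v := by
        have h : W.1 * (W⁻¹).1 = 1 := by
          rw [← Matrix.SpecialLinearGroup.coe_mul, mul_inv_cancel, Matrix.SpecialLinearGroup.coe_one]
        simp only [toAdd_ofAdd, Matrix.mulVec_mulVec, h, Matrix.one_mulVec, ofAdd_toAdd]
      map_mul' v w := by
        simp only [toAdd_mul, Matrix.mulVec_add, ofAdd_add] }
  map_one' := by
    ext v : 1
    change Multiplicative.ofAdd ((1 : Matrix.SpecialLinearGroup (Fin m) R).1 *ᵥ v.toAdd) = v
    rw [Matrix.SpecialLinearGroup.coe_one, Matrix.one_mulVec, ofAdd_toAdd]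
  map_mul' W X := by
    ext v : 1
    change Multiplicative.ofAdd ((W * X).1 *ᵥ v.toAdd)
      = Multiplicative.ofAdd (W.1 *ᵥ (X.1 *ᵥ v.toAdd))
    rw [Matrix.SpecialLinearGroup.coe_mul, Matrix.mulVec_mulVec]

variable {m R} in
/-- The symmetric matrix `W v Wᵗ`, for `v` symmetric. -/
def congrSym (W : Matrix (Fin m) (Fin m) R) (v : symMatrices m R) : symMatrices m R :=
  ⟨W * v.1 * Wᵀ, by
    have hv : v.1ᵀ = v.1 := v.2
    change (W * v.1 * Wᵀ)ᵀ = W * v.1 * Wᵀ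
    simp only [Matrix.transpose_mul, Matrix.transpose_transpose, hv, Matrix.mul_assoc]⟩

variable {m R} in
theorem congrSym_congrSym (W X : Matrix (Fin m) (Fin m) R) (v : symMatrices m R) :
    congrSym W (congrSym X v) = congrSym (W * X) v := by
  apply Subtype.ext
  simp only [congrSym, Matrix.transpose_mul, Matrix.mul_assoc]

variable {m R} in
theorem congrSym_one (v : symMatrices m R) : congrSym 1 v = v := by
  apply Subtype.ext
  simp only [congrSym, Matrix.transpose_one, Matrix.mul_one, Matrix.one_mul]

variable {m R} in
theorem congrSym_add (W : Matrix (Fin m) (Fin m) R) (v w : symMatrices m R) :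
    congrSym W (v + w) = congrSym W v + congrSym W w := by
  apply Subtype.ext
  simp only [congrSym, AddSubgroup.coe_add, Matrix.mul_add, Matrix.add_mul]

/-- The action `v ↦ W v Wᵗ` of `SL_m(R)` on the additive group of symmetric matrices. -/
def symAction : Matrix.SpecialLinearGroup (Fin m) R →* MulAut (Multiplicative (symMatrices m R)) where
  toFun W :=
    { toFun v := .ofAdd (congrSym W.1 v.toAdd)
      invFun v := .ofAdd (congrSym (W⁻¹).1 v.toAdd)
      left_inv v := by
        have h : (W⁻¹).1 * W.1 = 1 := by
          rw [← Matrix.SpecialLinearGroup.coe_mul, inv_mul_cancel, Matrix.SpecialLinearGroup.coe_one]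
        simp only [toAdd_ofAdd, congrSym_congrSym, h, congrSym_one, ofAdd_toAdd]
      right_inv v := by
        have h : W.1 * (W⁻¹).1 = 1 := by
          rw [← Matrix.SpecialLinearGroup.coe_mul, mul_inv_cancel, Matrix.SpecialLinearGroup.coe_one]
        simp only [toAdd_ofAdd, congrSym_congrSym, h, congrSym_one, ofAdd_toAdd]
      map_mul' v w := by
        simp only [toAdd_mul, congrSym_add, ofAdd_add] }
  map_one' := by
    ext v : 1
    change Multiplicative.ofAdd (congrSym (1 : Matrix.SpecialLinearGroup (Fin m) R).1 v.toAdd) = v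
    rw [Matrix.SpecialLinearGroup.coe_one, congrSym_one, ofAdd_toAdd]
  map_mul' W X := by
    ext v : 1
    change Multiplicative.ofAdd (congrSym (W * X).1 v.toAdd)
      = Multiplicative.ofAdd (congrSym W.1 (congrSym X.1 v.toAdd))
    rw [Matrix.SpecialLinearGroup.coe_mul, congrSym_congrSym]

/-- The group `E_m(R) ⋉ R^m`. -/
abbrev ElemVec : Type _ :=
  Multiplicative (Fin m → R) ⋊[(vecAction m R).comp (elementaryGroup m R).subtype]
    elementaryGroup m R

/-- The group `E_m(R) ⋉ S^{m*}(R^m)`. -/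
abbrev ElemSym : Type _ :=
  Multiplicative (symMatrices m R) ⋊[(symAction m R).comp (elementaryGroup m R).subtype]
    elementaryGroup m R

/-- The group `SL_m(R) ⋉ S^{m*}(R^m)`. -/
abbrev SLSym : Type _ :=
  Multiplicative (symMatrices m R) ⋊[symAction m R] Matrix.SpecialLinearGroup (Fin m) R

end Groups

/-- The normal factor `N` of a semidirect product `N ⋊ G`, as a subgroup. -/
def normalFactor {N G : Type*} [Group N] [Group G] (φ : G →* MulAut N) : Subgroup (N ⋊[φ] G) :=
  (SemidirectProduct.inl : N →* N ⋊[φ] G).range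

instance normalFactor_normal {N G : Type*} [Group N] [Group G] (φ : G →* MulAut N) :
    (normalFactor φ).Normal := by
  rw [normalFactor, SemidirectProduct.range_inl_eq_ker_rightHom]
  infer_instance

end

/-! ### Quasi-cocycles and almost invariance under a normal subgroup -/

section QuasiCocycles

variable {𝕜 : Type*} [RCLike 𝕜] {G : Type*} [Group G] {V : Type*} [NormedAddCommGroup V]
  [NormedSpace 𝕜 V] {ρ : Representation 𝕜 G V} {b : G → V} {C : ℝ}

/-! Let `b` be a quasi-cocycle on `SL_3 ⋉ S`, with `S` the symmetric matrices. A matrix `u = r e₃₃`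
commutes with the upper left copy of `E_2 ⋉ S^{2*}` and with a copy of `E_2 ⋉ R^2` in the stabilizer
of the last basis vector. Commuting elements `g` move `b u` by an amount independent of `u`, so the
spectral gap given by `(T_B)` makes `b u` uniformly almost invariant under both normal factors
(`exists_norm_rep_sub_le_of_relativeTB`). Finitely many elements of these factors multiply to any
element of `S`, so `b u` is almost invariant under all of `S`.

As `S` is normal, this property passes to conjugates and bounded products of such `u`, which exhaust
`S`. Hence `b` is quasi-additive on `S` and, by Hyers' theorem, close to an additive map `F`. Such
an `F` is equivariant up to a bounded error, hence exactly. Unipotent shears grow linearly while `ρ`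
is isometric, so `F = 0` and `b` is bounded on `S`. -/

theorem norm_rep_sub_le_mul (hρ : IsIsometricRep ρ) {g h : G} {ξ : V} {K L : ℝ}
    (hg : ‖ρ g ξ - ξ‖ ≤ K) (hh : ‖ρ h ξ - ξ‖ ≤ L) : ‖ρ (g * h) ξ - ξ‖ ≤ K + L := by
  have e : ρ (g * h) ξ - ξ = (ρ g ξ - ξ) + ρ g (ρ h ξ - ξ) := by
    rw [map_mul, Module.End.mul_apply, map_sub]; abel
  rw [e]
  exact (norm_add_le _ _).trans (add_le_add hg ((hρ _ _).trans_le hh))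

theorem norm_rep_inv_sub (hρ : IsIsometricRep ρ) (g : G) (ξ : V) :
    ‖ρ g⁻¹ ξ - ξ‖ = ‖ρ g ξ - ξ‖ := by
  rw [← hρ g (ρ g⁻¹ ξ - ξ), map_sub, Representation.self_inv_apply, norm_sub_rev]

/-- Expand `b (g * n) = b (n * g)` both ways. The point is that the bound does not depend on `n`. -/
theorem norm_rep_sub_le_of_commute (hρ : IsIsometricRep ρ)
    (hb : ∀ g h : G, ‖b (g * h) - b g - ρ g (b h)‖ ≤ C) {g n : G} (h : g * n = n * g) :
    ‖ρ g (b n) - b n‖ ≤ 2 * C + 2 * ‖b g‖ := by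
  have h1 := hb g n
  have h2 := hb n g
  have e : ρ g (b n) - b n =
      ((b (n * g) - b n - ρ n (b g)) - (b (g * n) - b g - ρ g (b n))) + (ρ n (b g) - b g) := by
    rw [h]; abel
  rw [e]
  have h3 := norm_add_le ((b (n * g) - b n - ρ n (b g)) - (b (g * n) - b g - ρ g (b n)))
    (ρ n (b g) - b g)
  have h4 := norm_sub_le (b (n * g) - b n - ρ n (b g)) (b (g * n) - b g - ρ g (b n))
  have h5 := norm_sub_le (ρ n (b g)) (b g)
  rw [hρ] at h5
  linarith

theorem norm_quasiCocycle_conj_sub_le (hρ : IsIsometricRep ρ)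
    (hb : ∀ g h : G, ‖b (g * h) - b g - ρ g (b h)‖ ≤ C) (g n : G) :
    ‖b (g * n * g⁻¹) - ρ g (b n)‖ ≤ 2 * C + ‖b g‖ + ‖b g⁻¹‖ := by
  have h1 := hb (g * n) g⁻¹
  have h2 := hb g n
  have e : b (g * n * g⁻¹) - ρ g (b n) = (b (g * n * g⁻¹) - b (g * n) - ρ (g * n) (b g⁻¹)) +
      (b (g * n) - b g - ρ g (b n)) + b g + ρ (g * n) (b g⁻¹) := by abel
  rw [e]
  refine norm_add_le_of_le (norm_add_le_of_le ((norm_add_le_of_le h1 h2).trans ?_) le_rfl)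
    (hρ _ _).le
  linarith

/-- Relative `(T_B)` forces a quasi-cocycle to take uniformly almost invariant values on the
centralizer. -/
theorem exists_norm_rep_sub_le_of_relativeTB {G' : Type*} [Group G'] {N : Subgroup G'} [N.Normal]
    (hT : HasRelativeTB 𝕜 V N) (φ : G' →* G) (hρ : IsIsometricRep ρ) (hb : IsQuasiCocycle ρ b) :
    ∃ K : ℝ, ∀ u : G, (∀ g, φ g * u = u * φ g) → ∀ h ∈ N, ‖ρ (φ h) (b u) - b u‖ ≤ K := by
  obtain ⟨C, hC⟩ := hb
  have hρ' : IsIsometricRep (ρ.comp φ) := fun g ξ => hρ (φ g) ξ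
  have h := hT (ρ.comp φ) hρ'
  unfold HasAlmostInvariantVectors at h
  push Not at h
  obtain ⟨ε, hε, S, hS⟩ := h
  -- The sum dominates each of its terms, giving one constant for whichever `s` witnesses the gap;
  -- `|C|` keeps all terms nonnegative.
  set D : ℝ := ∑ s ∈ S, (2 * |C| + 2 * ‖b (φ s)‖) with hD
  refine ⟨2 * (D / ε + 1), fun u hu h hh => ?_⟩
  obtain ⟨s, hs, hle⟩ := hS (Submodule.Quotient.mk (b u))
  have h1 : ‖b u - ρ (φ s) (b u)‖ ≤ D := by
    rw [norm_sub_rev]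
    refine (norm_rep_sub_le_of_commute hρ hC (hu s)).trans (le_trans ?_
      (Finset.single_le_sum (f := fun s => 2 * |C| + 2 * ‖b (φ s)‖)
        (fun i _ => by positivity) hs))
    have := le_abs_self C
    linarith
  have h2 : ε * ‖(Submodule.Quotient.mk (b u) : V ⧸ invariantsOf (ρ.comp φ) N)‖ ≤ D := by
    refine hle.trans (le_trans ?_ h1)
    exact Submodule.Quotient.norm_mk_le (invariantsOf (ρ.comp φ) N) (b u - ρ (φ s) (b u))
  -- A representative of almost minimal norm differs from `b u` by an `N`-invariant vector, so `N`
  -- moves `b u` exactly as it moves `η`, by at most `2 * ‖η‖`.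
  obtain ⟨η, hη, hlt⟩ := Submodule.Quotient.norm_mk_lt
    (S := invariantsOf (ρ.comp φ) N) (Submodule.Quotient.mk (b u)) one_pos
  have h3 : η - b u ∈ invariantsOf (ρ.comp φ) N := (Submodule.Quotient.eq _).1 hη
  have h4 : ρ (φ h) (η - b u) = η - b u := h3 ⟨h, hh⟩
  have h5 : ρ (φ h) (b u) - b u = ρ (φ h) η - η := by
    rw [map_sub] at h4
    rw [sub_eq_sub_iff_add_eq_add] at h4 ⊢
    rw [add_comm, ← h4, add_comm]
  have h6 : ‖(Submodule.Quotient.mk (b u) : V ⧸ invariantsOf (ρ.comp φ) N)‖ ≤ D / ε := by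
    rw [le_div_iff₀ hε, mul_comm]; exact h2
  rw [h5]
  have h7 := norm_sub_le (ρ (φ h) η) η
  rw [hρ] at h7
  linarith

/-- The values of `b` on `X` are uniformly almost invariant under `N`. -/
def UniformlyAlmostInvariantOn (ρ : Representation 𝕜 G V) (b : G → V) (N : Subgroup G)
    (X : Set G) : Prop :=
  ∃ K : ℝ, ∀ u ∈ X, ∀ m ∈ N, ‖ρ m (b u) - b u‖ ≤ K

/-- Moving `m` past `x` replaces it by `x⁻¹ * m * x`, which stays in `N` by normality. -/
theorem UniformlyAlmostInvariantOn.mul {N : Subgroup G} [N.Normal] {X Y : Set G}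
    (hX : UniformlyAlmostInvariantOn ρ b N X) (hY : UniformlyAlmostInvariantOn ρ b N Y)
    (hρ : IsIsometricRep ρ) (hb : IsQuasiCocycle ρ b) :
    UniformlyAlmostInvariantOn ρ b N (Set.image2 (· * ·) X Y) := by
  obtain ⟨K, hK⟩ := hX
  obtain ⟨L, hL⟩ := hY
  obtain ⟨C, hC⟩ := hb
  refine ⟨C + C + K + L, ?_⟩
  rintro _ ⟨x, hx, y, hy, rfl⟩ m hm
  have h1 := hK x hx m hm
  have h2 := hL y hy (x⁻¹ * m * x) (by simpa using ‹N.Normal›.conj_mem m hm x⁻¹)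
  have e : ρ m (b (x * y)) - b (x * y) = ρ m (b (x * y) - b x - ρ x (b y)) -
      (b (x * y) - b x - ρ x (b y)) + (ρ m (b x) - b x) +
      ρ x (ρ (x⁻¹ * m * x) (b y) - b y) := by
    have : ρ x (ρ (x⁻¹ * m * x) (b y)) = ρ m (ρ x (b y)) := by
      rw [← Module.End.mul_apply, ← Module.End.mul_apply, ← map_mul, ← map_mul]; group
    simp only [map_sub, this]; abel
  change ‖ρ m (b (x * y)) - b (x * y)‖ ≤ _
  rw [e]
  refine norm_add_le_of_le (norm_add_le_of_le (norm_sub_le_of_le ?_ (hC _ _)) h1) ?_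
  · rw [hρ]; exact hC _ _
  · rw [hρ]; exact h2

theorem UniformlyAlmostInvariantOn.conj {N : Subgroup G} [N.Normal] {X : Set G}
    (hX : UniformlyAlmostInvariantOn ρ b N X)
    (hρ : IsIsometricRep ρ) (hb : IsQuasiCocycle ρ b) (g : G) :
    UniformlyAlmostInvariantOn ρ b N ((fun x => g * x * g⁻¹) '' X) := by
  obtain ⟨K, hK⟩ := hX
  obtain ⟨C, hC⟩ := hb
  refine ⟨(2 * C + ‖b g‖ + ‖b g⁻¹‖) + (2 * C + ‖b g‖ + ‖b g⁻¹‖) + K, ?_⟩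
  rintro _ ⟨x, hx, rfl⟩ m hm
  have h1 := hK x hx (g⁻¹ * m * g) (by simpa using ‹N.Normal›.conj_mem m hm g⁻¹)
  have h2 := norm_quasiCocycle_conj_sub_le hρ hC g x
  have e : ρ m (b (g * x * g⁻¹)) - b (g * x * g⁻¹) = ρ m (b (g * x * g⁻¹) - ρ g (b x)) -
      (b (g * x * g⁻¹) - ρ g (b x)) + ρ g (ρ (g⁻¹ * m * g) (b x) - b x) := by
    have : ρ g (ρ (g⁻¹ * m * g) (b x)) = ρ m (ρ g (b x)) := by
      rw [← Module.End.mul_apply, ← Module.End.mul_apply, ← map_mul, ← map_mul]; group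
    simp only [map_sub, this]; abel
  change ‖ρ m (b (g * x * g⁻¹)) - b (g * x * g⁻¹)‖ ≤ _
  rw [e]
  refine norm_add_le_of_le (norm_sub_le_of_le ?_ h2) ?_
  · rw [hρ]; exact h2
  · rw [hρ]; exact h1

end QuasiCocycles

/-! ### Additive maps near quasi-additive maps -/

section Homogenization

theorem eq_zero_of_norm_nsmul_le {V : Type*} [NormedAddCommGroup V] [NormedSpace ℝ V] {v : V}
    {K : ℝ} (h : ∀ n : ℕ, ‖n • v‖ ≤ K) : v = 0 := by
  by_contra hv
  obtain ⟨n, hn⟩ := exists_nat_gt (K / ‖v‖)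
  rw [div_lt_iff₀ (norm_pos_iff.2 hv)] at hn
  have := h n
  rw [← Nat.cast_smul_eq_nsmul ℝ, norm_smul, Real.norm_natCast] at this
  linarith

theorem AddMonoidHom.eq_zero_of_norm_le {M V : Type*} [AddCommGroup M] [NormedAddCommGroup V]
    [NormedSpace ℝ V] {F : M →+ V} {K : ℝ} (h : ∀ x, ‖F x‖ ≤ K) : F = 0 := by
  ext x
  exact eq_zero_of_norm_nsmul_le fun n => by rw [← map_nsmul]; exact h _

/-- Hyers' theorem: a quasi-additive map to a Banach space is close to an additive map. -/
theorem exists_addMonoidHom_norm_sub_le {M V : Type*} [AddCommGroup M] [NormedAddCommGroup V]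
    [NormedSpace ℝ V] [CompleteSpace V] {f : M → V} {C : ℝ}
    (hf : ∀ x y, ‖f (x + y) - f x - f y‖ ≤ C) : ∃ F : M →+ V, ∀ x, ‖F x - f x‖ ≤ C := by
  -- Successive doublings differ by at most `C / 2 / 2 ^ n`, which sums to `C`.
  let u : M → ℕ → V := fun x n => ((2 : ℝ)⁻¹ ^ n) • f (2 ^ n • x)
  have hu : ∀ x n, dist (u x n) (u x (n + 1)) ≤ C / 2 / 2 ^ n := by
    intro x n
    have e : u x (n + 1) - u x n =
        ((2 : ℝ)⁻¹ ^ (n + 1)) • (f (2 ^ n • x + 2 ^ n • x) - f (2 ^ n • x) - f (2 ^ n • x)) := by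
      simp only [u, smul_sub, pow_succ, mul_two, add_nsmul]
      rw [sub_sub]
      congr 1
      rw [← add_smul]
      congr 1
      ring
    rw [dist_eq_norm, norm_sub_rev, e, norm_smul, norm_pow, norm_inv, Real.norm_ofNat]
    calc (2 : ℝ)⁻¹ ^ (n + 1) * _ ≤ (2 : ℝ)⁻¹ ^ (n + 1) * C := by gcongr; exact hf _ _
      _ = C / 2 / 2 ^ n := by rw [inv_pow, pow_succ]; field_simp
  choose F hF using fun x => cauchySeq_tendsto_of_complete (cauchySeq_of_le_geometric_two (hu x))
  refine ⟨AddMonoidHom.mk' F fun x y => ?_, fun x => ?_⟩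
  · have h1 := ((hF (x + y)).sub (hF x)).sub (hF y)
    have h2 : Filter.Tendsto (fun n => u (x + y) n - u x n - u y n) Filter.atTop (nhds 0) := by
      have h3 : Filter.Tendsto (fun n : ℕ => (2 : ℝ)⁻¹ ^ n * C) Filter.atTop (nhds 0) := by
        simpa using (tendsto_pow_atTop_nhds_zero_of_lt_one (r := (2 : ℝ)⁻¹)
          (by norm_num) (by norm_num)).mul_const C
      refine squeeze_zero_norm (fun n => ?_) h3
      simp only [u, ← smul_sub, smul_add]
      rw [norm_smul, norm_pow, norm_inv, Real.norm_ofNat]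
      gcongr
      exact hf _ _
    have := tendsto_nhds_unique h1 h2
    rw [sub_sub, sub_eq_zero] at this
    exact this
  · have := dist_le_of_le_geometric_two_of_tendsto₀ (hu x) (hF x)
    simpa [u, dist_eq_norm, norm_sub_rev] using this

end Homogenization

/-! ### Embeddings of the rank two groups -/

section Embeddings

variable {R : Type*} [CommRing R]

/-- The symmetric `3 × 3` matrix with the given entries. -/
def symThree (a b c d e f : R) : symMatrices 3 R :=
  ⟨!![a, d, e; d, b, f; e, f, c], by
    change _ᵀ = _
    ext i j; fin_cases i <;> fin_cases j <;> rfl⟩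

theorem eq_symThree (s : symMatrices 3 R) :
    s = symThree (s.1 0 0) (s.1 1 1) (s.1 2 2) (s.1 0 1) (s.1 0 2) (s.1 1 2) := by
  have h : ∀ i j, s.1 i j = s.1 j i := fun i j => Matrix.IsSymm.apply s.2 j i
  apply Subtype.ext
  ext i j
  fin_cases i <;> fin_cases j <;> simp [symThree, h 1 0, h 2 0, h 2 1]

theorem symThree_add (a b c d e f a' b' c' d' e' f' : R) :
    symThree a b c d e f + symThree a' b' c' d' e' f' =
      symThree (a + a') (b + b') (c + c') (d + d') (e + e') (f + f') := by
  apply Subtype.ext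
  ext i j
  fin_cases i <;> fin_cases j <;> rfl

theorem congrSym_symThree (W : Matrix (Fin 3) (Fin 3) R) (a b c d e f : R) :
    (congrSym W (symThree a b c d e f)).1 = W * !![a, d, e; d, b, f; e, f, c] * Wᵀ := rfl

theorem congrSym_single (W : Matrix (Fin 3) (Fin 3) R) (r : R) :
    congrSym W (symThree 0 0 r 0 0 0) =
      symThree (r * W 0 2 ^ 2) (r * W 1 2 ^ 2) (r * W 2 2 ^ 2) (r * (W 0 2 * W 1 2))
        (r * (W 0 2 * W 2 2)) (r * (W 1 2 * W 2 2)) := by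
  apply Subtype.ext
  rw [congrSym_symThree]
  ext i j
  fin_cases i <;> fin_cases j <;>
    simp [symThree, Matrix.mul_apply, Fin.sum_univ_three] <;> ring

/-- The block diagonal matrix with blocks `W` and `1`. -/
def blockMatrix (W : Matrix (Fin 2) (Fin 2) R) : Matrix (Fin 3) (Fin 3) R :=
  !![W 0 0, W 0 1, 0; W 1 0, W 1 1, 0; 0, 0, 1]

theorem blockMatrix_mul (W X : Matrix (Fin 2) (Fin 2) R) :
    blockMatrix (W * X) = blockMatrix W * blockMatrix X := by
  ext i j
  fin_cases i <;> fin_cases j <;>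
    simp [blockMatrix, Matrix.mul_apply, Fin.sum_univ_two, Fin.sum_univ_three]

/-- The inclusion `SL_2 → SL_3` as the upper left block. -/
def blockSL : Matrix.SpecialLinearGroup (Fin 2) R →* Matrix.SpecialLinearGroup (Fin 3) R :=
  MonoidHom.mk' (fun W => ⟨blockMatrix W.1, by
    have h := W.2
    rw [Matrix.det_fin_two] at h
    simp [blockMatrix, Matrix.det_fin_three, h]⟩)
    fun W X => Subtype.ext (blockMatrix_mul W.1 X.1)

/-- The inclusion of symmetric `2 × 2` matrices as the upper left block. -/
def blockSym : symMatrices 2 R →+ symMatrices 3 R where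
  toFun v := symThree (v.1 0 0) (v.1 1 1) 0 (v.1 0 1) 0 0
  map_zero' := by
    apply Subtype.ext
    ext i j
    fin_cases i <;> fin_cases j <;> rfl
  map_add' v w := by simp [symThree_add]

theorem blockSym_congrSym (W : Matrix.SpecialLinearGroup (Fin 2) R) (v : symMatrices 2 R) :
    blockSym (congrSym W.1 v) = congrSym (blockSL W).1 (blockSym v) := by
  have h : v.1 1 0 = v.1 0 1 := Matrix.IsSymm.apply v.2 0 1
  apply Subtype.ext
  change _ = blockMatrix W.1 * _ * (blockMatrix W.1)ᵀ
  ext i j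
  fin_cases i <;> fin_cases j <;>
    simp [blockSym, blockMatrix, symThree, congrSym, Matrix.mul_apply, Fin.sum_univ_two,
      Fin.sum_univ_three, h]
  ring

/-- The inclusion `E_2(R) ⋉ S^{2*}(R^2) → SL_3(R) ⋉ S^{3*}(R^3)` as the upper left block. -/
def elemSymToSLSym : ElemSym 2 R →* SLSym 3 R :=
  SemidirectProduct.map (AddMonoidHom.toMultiplicative blockSym)
    (blockSL.comp (elementaryGroup 2 R).subtype) fun W =>
      MonoidHom.ext fun v => congrArg Multiplicative.ofAdd (blockSym_congrSym W.1 v.toAdd)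

/-- The contragredient of the affine matrix with linear part `W` and translation part `v`, for
`W` of determinant one. -/
def contraAffine (v : Fin 2 → R) (W : Matrix (Fin 2) (Fin 2) R) : Matrix (Fin 3) (Fin 3) R :=
  !![W 1 1, -W 1 0, 0; -W 0 1, W 0 0, 0;
    v 1 * W 0 1 - v 0 * W 1 1, v 0 * W 1 0 - v 1 * W 0 0, 1]

theorem det_contraAffine (v : Fin 2 → R) (W : Matrix (Fin 2) (Fin 2) R) :
    (contraAffine v W).det = W.det := by
  simp [contraAffine, Matrix.det_fin_three, Matrix.det_fin_two]
  ring

/-- The inverse transpose is written with cofactors, so `det W = 1` is needed only to cancel `W`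
against its adjugate in the last row. -/
theorem contraAffine_mul (v w : Fin 2 → R) {W : Matrix (Fin 2) (Fin 2) R}
    (X : Matrix (Fin 2) (Fin 2) R) (hW : W.det = 1) :
    contraAffine (v + W *ᵥ w) (W * X) = contraAffine v W * contraAffine w X := by
  rw [Matrix.det_fin_two] at hW
  ext i j
  fin_cases i <;> fin_cases j <;>
    simp [contraAffine, Matrix.mul_apply, Fin.sum_univ_two,
      Fin.sum_univ_three]
  · ring
  · ring
  · linear_combination (w 1 * X 0 1 - w 0 * X 1 1) * hW
  · linear_combination (w 0 * X 1 0 - w 1 * X 0 0) * hW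

/-- The contragredient affine inclusion `E_2(R) ⋉ R^2 → SL_3(R)`, whose image fixes the last basis
vector. -/
def elemVecToSL : ElemVec 2 R →* Matrix.SpecialLinearGroup (Fin 3) R :=
  MonoidHom.mk' (fun x => ⟨contraAffine x.left.toAdd x.right.1.1, by
      rw [det_contraAffine, x.right.1.2]⟩)
    fun x y => Subtype.ext (contraAffine_mul x.left.toAdd y.left.toAdd y.right.1.1 x.right.1.2)

end Embeddings

/-! ### Bounded generation of the symmetric matrices -/

section SymmetricMatrices

variable {R : Type*} [CommRing R]

/-- The inclusion of symmetric matrices in `SL_3(R) ⋉ S^{3*}(R^3)`. -/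
abbrev symInl (s : symMatrices 3 R) : SLSym 3 R := SemidirectProduct.inl (.ofAdd s)

/-- The inclusion of `SL_3(R)` in `SL_3(R) ⋉ S^{3*}(R^3)`. -/
abbrev slInr : Matrix.SpecialLinearGroup (Fin 3) R →* SLSym 3 R := SemidirectProduct.inr

theorem symInl_add (s t : symMatrices 3 R) : symInl (s + t) = symInl s * symInl t := by
  simp only [symInl, ofAdd_add, map_mul]

theorem symInl_congrSym (W : Matrix.SpecialLinearGroup (Fin 3) R) (s : symMatrices 3 R) :
    symInl (congrSym W.1 s) = slInr W * symInl s * (slInr W)⁻¹ := by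
  rw [← map_inv]
  exact SemidirectProduct.inl_aut (φ := symAction 3 R) W (.ofAdd s)

theorem mul_symInl_of_congrSym_eq {g : SLSym 3 R} {s : symMatrices 3 R}
    (h : congrSym g.right.1 s = s) : g * symInl s = symInl s * g := by
  refine SemidirectProduct.ext ?_ ?_
  · rw [SemidirectProduct.mul_left, SemidirectProduct.mul_left]
    have h1 : symAction 3 R g.right (symInl s).left = (symInl s).left :=
      congrArg Multiplicative.ofAdd h
    rw [h1, mul_comm]
    simp
  · simp

theorem elemSymToSLSym_mul_symInl (g : ElemSym 2 R) (r : R) :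
    elemSymToSLSym g * symInl (symThree 0 0 r 0 0 0) =
      symInl (symThree 0 0 r 0 0 0) * elemSymToSLSym g := by
  apply mul_symInl_of_congrSym_eq
  change congrSym (blockMatrix g.right.1.1) _ = _
  rw [congrSym_single]
  simp [blockMatrix]

theorem slInr_elemVecToSL_mul_symInl (g : ElemVec 2 R) (r : R) :
    slInr (elemVecToSL g) * symInl (symThree 0 0 r 0 0 0) =
      symInl (symThree 0 0 r 0 0 0) * slInr (elemVecToSL g) := by
  apply mul_symInl_of_congrSym_eq
  change congrSym (contraAffine g.left.toAdd g.right.1.1) _ = _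
  rw [congrSym_single]
  simp [contraAffine]

/-- Elements of `SL_3(R)` sending the last basis vector to `e₁`, `e₂`, `e₃`, `e₁ + e₂`, `e₁ + e₃`
and `e₂ + e₃`. -/
def columnSL : Fin 6 → Matrix.SpecialLinearGroup (Fin 3) R :=
  ![⟨!![0, 0, 1; 1, 0, 0; 0, 1, 0], by simp [Matrix.det_fin_three]⟩,
    ⟨!![0, 1, 0; 0, 0, 1; 1, 0, 0], by simp [Matrix.det_fin_three]⟩,
    1,
    ⟨!![0, 0, 1; 1, 0, 1; 0, 1, 0], by simp [Matrix.det_fin_three]⟩,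
    ⟨!![1, 0, 1; 0, 1, 0; 0, 0, 1], by simp [Matrix.det_fin_three]⟩,
    ⟨!![1, 0, 0; 0, 1, 1; 0, 0, 1], by simp [Matrix.det_fin_three]⟩]

theorem exists_eq_sum_congrSym_columnSL (s : symMatrices 3 R) :
    ∃ r : Fin 6 → R, s = ∑ k, congrSym (columnSL k).1 (symThree 0 0 (r k) 0 0 0) := by
  -- Polarization without dividing by 2: each off-diagonal entry is the coefficient of `(eᵢ + eⱼ)(eᵢ
  -- + eⱼ)ᵗ`, and the diagonal ones are corrected accordingly.
  refine ⟨![s.1 0 0 - s.1 0 1 - s.1 0 2, s.1 1 1 - s.1 0 1 - s.1 1 2,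
    s.1 2 2 - s.1 0 2 - s.1 1 2, s.1 0 1, s.1 0 2, s.1 1 2], ?_⟩
  conv_lhs => rw [eq_symThree s]
  simp only [congrSym_single, Fin.sum_univ_six, symThree_add]
  simp [columnSL]
  congr 1 <;> ring

/-- The lower unipotent `1 + a e₃₁ + c e₃₂`. -/
def lowerSL (a c : R) : Matrix.SpecialLinearGroup (Fin 3) R :=
  elemVecToSL (SemidirectProduct.inl (.ofAdd ![-a, -c]))

theorem coe_lowerSL (a c : R) : (lowerSL a c).1 = !![1, 0, 0; 0, 1, 0; a, c, 1] := by
  change contraAffine ![-a, -c] 1 = _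
  simp [contraAffine]

theorem exists_eq_congrSym_lowerSL_add (s : symMatrices 3 R) :
    ∃ u v w : symMatrices 2 R, s = congrSym (lowerSL 1 0).1 (blockSym u) +
      congrSym (lowerSL 0 1).1 (blockSym v) + blockSym w := by
  have hsym : ∀ a b c : R, !![a, b; b, c] ∈ symMatrices 2 R := fun a b c => by
    change _ᵀ = _
    ext i j; fin_cases i <;> fin_cases j <;> rfl
  have h : ∀ i j, s.1 i j = s.1 j i := fun i j => Matrix.IsSymm.apply s.2 j i
  -- The first shear, `e₁ ↦ e₁ + e₃`, produces the entries 22 and 12 (indices from 0); the second,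
  -- `e₂ ↦ e₂ + e₃`, corrects the entry 02; the last summand repairs the upper left block.
  refine ⟨⟨_, hsym (s.1 2 2) (s.1 1 2) 0⟩, ⟨_, hsym 0 (s.1 0 2 - s.1 2 2) 0⟩,
    ⟨_, hsym (s.1 0 0 - s.1 2 2) (s.1 0 1 - s.1 1 2 - s.1 0 2 + s.1 2 2) (s.1 1 1)⟩, ?_⟩
  apply Subtype.ext
  rw [AddSubgroup.coe_add, AddSubgroup.coe_add, coe_lowerSL, coe_lowerSL]
  ext i j
  fin_cases i <;> fin_cases j <;>
    simp [blockSym, congrSym, symThree, Matrix.vecMul, dotProduct, Fin.sum_univ_three, h 1 0, h 2 0,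
      h 2 1] <;> ring

/-- The shear `e₂ ↦ e₂ + n e₃` adds `2nr e₃₃`: this linear growth is what contradicts isometry in
`eq_zero_of_equivariant`. -/
theorem congrSym_lowerSL_natCast (n : ℕ) (r : R) :
    congrSym (lowerSL 0 (n : R)).1 (symThree 0 0 0 0 0 r) =
      symThree 0 0 0 0 0 r + n • (symThree 0 0 r 0 0 0 + symThree 0 0 r 0 0 0) := by
  apply Subtype.ext
  rw [coe_lowerSL, congrSym_symThree]
  ext i j
  fin_cases i <;> fin_cases j <;>
    simp [symThree, Matrix.mul_apply, Fin.sum_univ_three]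
  ring

end SymmetricMatrices

/-! ### From relative `(T_B)` to boundedness -/

section Main

variable {R : Type*} [CommRing R] {𝕜 : Type*} [RCLike 𝕜] {B : Type*} [NormedAddCommGroup B]
  [NormedSpace 𝕜 B] {ρ : Representation 𝕜 (SLSym 3 R) B} {b : SLSym 3 R → B}

theorem uniformlyAlmostInvariantOn_single
    (hvec : HasRelativeTB (G := ElemVec 2 R) 𝕜 B (normalFactor _))
    (hsym : HasRelativeTB (G := ElemSym 2 R) 𝕜 B (normalFactor _))
    (hρ : IsIsometricRep ρ) (hb : IsQuasiCocycle ρ b) :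
    UniformlyAlmostInvariantOn ρ b (normalFactor _)
      (Set.range fun r : R => symInl (symThree 0 0 r 0 0 0)) := by
  obtain ⟨K, hK⟩ := exists_norm_rep_sub_le_of_relativeTB hsym elemSymToSLSym hρ hb
  obtain ⟨L, hL⟩ := exists_norm_rep_sub_le_of_relativeTB hvec (slInr.comp elemVecToSL) hρ hb
  refine ⟨(L + K + L) + (L + K + L) + K, ?_⟩
  rintro _ ⟨r, rfl⟩ _ ⟨m, rfl⟩
  have hS : ∀ v : symMatrices 2 R, ‖ρ (symInl (blockSym v)) (b (symInl (symThree 0 0 r 0 0 0))) -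
      b (symInl (symThree 0 0 r 0 0 0))‖ ≤ K := fun v => by
    have := hK _ (fun g => elemSymToSLSym_mul_symInl g r) (SemidirectProduct.inl (.ofAdd v))
      ⟨_, rfl⟩
    rwa [elemSymToSLSym, SemidirectProduct.map_inl] at this
  have hE : ∀ a c : R, ‖ρ (slInr (lowerSL a c)) (b (symInl (symThree 0 0 r 0 0 0))) -
      b (symInl (symThree 0 0 r 0 0 0))‖ ≤ L := fun a c =>
    hL _ (fun g => slInr_elemVecToSL_mul_symInl g r) (SemidirectProduct.inl (.ofAdd ![-a, -c]))
      ⟨_, rfl⟩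
  -- A sheared block is a conjugate of a block element by a translation of `E_2 ⋉ R^2`, whence the
  -- three-factor cost `L + K + L`.
  have hc : ∀ (a c : R) (v : symMatrices 2 R),
      ‖ρ (symInl (congrSym (lowerSL a c).1 (blockSym v)))
        (b (symInl (symThree 0 0 r 0 0 0))) - b (symInl (symThree 0 0 r 0 0 0))‖ ≤ L + K + L := by
    intro a c v
    rw [symInl_congrSym]
    refine norm_rep_sub_le_mul hρ (norm_rep_sub_le_mul hρ (hE _ _) (hS v)) ?_
    rw [norm_rep_inv_sub hρ]
    exact hE _ _
  obtain ⟨u, v, w, h⟩ := exists_eq_congrSym_lowerSL_add m.toAdd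
  have hm : (SemidirectProduct.inl m : SLSym 3 R) = symInl m.toAdd := rfl
  rw [hm, h, symInl_add, symInl_add]
  exact norm_rep_sub_le_mul hρ (norm_rep_sub_le_mul hρ (hc _ _ _) (hc _ _ _)) (hS _)

theorem UniformlyAlmostInvariantOn.normalFactor_of_single
    (h : UniformlyAlmostInvariantOn ρ b (normalFactor _)
      (Set.range fun r : R => symInl (symThree 0 0 r 0 0 0)))
    (hρ : IsIsometricRep ρ) (hb : IsQuasiCocycle ρ b) :
    UniformlyAlmostInvariantOn ρ b (normalFactor _)
      (normalFactor _ : Subgroup (SLSym 3 R)) := by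
  have hg := fun k => h.conj hρ hb (slInr (columnSL k))
  obtain ⟨K, hK⟩ := ((((((hg 0).mul (hg 1) hρ hb).mul (hg 2) hρ hb).mul (hg 3) hρ hb).mul
    (hg 4) hρ hb).mul (hg 5) hρ hb)
  refine ⟨K, ?_⟩
  rintro _ ⟨n, rfl⟩
  apply hK
  obtain ⟨r, hr⟩ := exists_eq_sum_congrSym_columnSL n.toAdd
  have hn : (SemidirectProduct.inl n : SLSym 3 R) = symInl n.toAdd := rfl
  rw [hn, hr, Fin.sum_univ_six]
  simp only [symInl_add, symInl_congrSym]
  have hmem : ∀ k, slInr (columnSL k) * symInl (symThree 0 0 (r k) 0 0 0) *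
      (slInr (columnSL k))⁻¹ ∈ (fun x => slInr (columnSL k) * x * (slInr (columnSL k))⁻¹) ''
        (Set.range fun r : R => symInl (symThree 0 0 r 0 0 0)) := fun k => ⟨_, ⟨r k, rfl⟩, rfl⟩
  exact Set.mem_image2_of_mem (Set.mem_image2_of_mem (Set.mem_image2_of_mem (Set.mem_image2_of_mem
    (Set.mem_image2_of_mem (hmem 0) (hmem 1)) (hmem 2)) (hmem 3)) (hmem 4)) (hmem 5)

/-- An additive map on symmetric matrices which is equivariant for an isometric representation
vanishes. -/
theorem eq_zero_of_equivariant [NormedSpace ℝ B] (hρ : IsIsometricRep ρ)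
    {F : symMatrices 3 R →+ B}
    (hF : ∀ (W : Matrix.SpecialLinearGroup (Fin 3) R) s, F (congrSym W.1 s) = ρ (slInr W) (F s)) :
    F = 0 := by
  have h1 : ∀ r : R, F (symThree 0 0 r 0 0 0) = 0 := by
    intro r
    have h2 : F (symThree 0 0 r 0 0 0 + symThree 0 0 r 0 0 0) = 0 := by
      -- By equivariance, `n` times the vector is a difference of two vectors of norm `‖F (symThree
      -- 0 0 0 0 0 r)‖`.
      refine eq_zero_of_norm_nsmul_le (K := 2 * ‖F (symThree 0 0 0 0 0 r)‖) fun n => ?_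
      have h3 := hF (lowerSL 0 n) (symThree 0 0 0 0 0 r)
      rw [congrSym_lowerSL_natCast, map_add, map_nsmul, ← eq_sub_iff_add_eq'] at h3
      rw [h3]
      refine (norm_sub_le _ _).trans ?_
      rw [hρ, two_mul]
    rw [map_add, ← two_smul ℝ] at h2
    exact (smul_eq_zero.1 h2).resolve_left two_ne_zero
  ext s
  obtain ⟨r, hr⟩ := exists_eq_sum_congrSym_columnSL s
  rw [hr, map_sum]
  simp [hF, h1]

theorem hasRelativeFFB_of_hasRelativeTB [CompleteSpace B]
    (hvec : HasRelativeTB (G := ElemVec 2 R) 𝕜 B (normalFactor _))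
    (hsym : HasRelativeTB (G := ElemSym 2 R) 𝕜 B (normalFactor _)) :
    HasRelativeFFB (G := SLSym 3 R) 𝕜 B (normalFactor _ : Subgroup (SLSym 3 R)) := by
  let _ : NormedSpace ℝ B := NormedSpace.restrictScalars ℝ 𝕜 B
  intro ρ hρ b hb
  obtain ⟨K, hK⟩ := (uniformlyAlmostInvariantOn_single hvec hsym hρ hb).normalFactor_of_single hρ hb
  obtain ⟨C, hC⟩ := hb
  obtain ⟨F, hF⟩ := exists_addMonoidHom_norm_sub_le (f := fun s => b (symInl s)) (C := C + K) (by
    intro x y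
    have h1 := hC (symInl x) (symInl y)
    have h2 := hK (symInl y) ⟨_, rfl⟩ (symInl x) ⟨_, rfl⟩
    rw [symInl_add]
    have e : b (symInl x * symInl y) - b (symInl x) - b (symInl y) =
      (b (symInl x * symInl y) - b (symInl x) - ρ (symInl x) (b (symInl y))) +
        (ρ (symInl x) (b (symInl y)) - b (symInl y)) := by abel
    rw [e]
    exact norm_add_le_of_le h1 h2)
  have h0 : F = 0 := by
    refine eq_zero_of_equivariant hρ fun W => ?_
    let conjHom : symMatrices 3 R →+ symMatrices 3 R :=
      AddMonoidHom.mk' (congrSym W.1) (congrSym_add W.1)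
    -- The defect of equivariance is additive in `s` and bounded, hence zero.
    have h1 : F.comp conjHom - (ρ (slInr W)).toAddMonoidHom.comp F = 0 := by
      refine AddMonoidHom.eq_zero_of_norm_le
        (K := (C + K) + (2 * C + ‖b (slInr W)‖ + ‖b (slInr W)⁻¹‖) + (C + K)) fun s => ?_
      have h2 := hF (congrSym W.1 s)
      have h3 := norm_quasiCocycle_conj_sub_le hρ hC (slInr W) (symInl s)
      rw [← symInl_congrSym] at h3
      have h4 := hρ (slInr W) (b (symInl s) - F s)
      rw [norm_sub_rev (b (symInl s)), map_sub] at h4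
      have h5 := h4.trans_le (hF s)
      change ‖F (congrSym W.1 s) - ρ (slInr W) (F s)‖ ≤ _
      have e : F (congrSym W.1 s) - ρ (slInr W) (F s) =
          (F (congrSym W.1 s) - b (symInl (congrSym W.1 s))) +
          (b (symInl (congrSym W.1 s)) - ρ (slInr W) (b (symInl s))) +
          (ρ (slInr W) (b (symInl s)) - ρ (slInr W) (F s)) := by abel
      rw [e]
      exact norm_add_le_of_le (norm_add_le_of_le h2 h3) h5
    intro s
    exact sub_eq_zero.1 (DFunLike.congr_fun h1 s)
  refine ⟨C + K, ?_⟩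
  rintro _ ⟨n, rfl⟩
  have := hF n.toAdd
  rwa [h0, AddMonoidHom.zero_apply, zero_sub, norm_neg] at this

end Main

theorem proposition6p6 (k : ℕ) {𝕜 : Type*} [RCLike 𝕜]
    (B : Type*) [NormedAddCommGroup B] [NormedSpace 𝕜 B] [CompleteSpace B]
    (hB : IsSuperreflexive 𝕜 B)
    (hvec : HasRelativeTB (G := ElemVec 2 (MvPolynomial (Fin k) ℤ)) 𝕜 B (normalFactor _))
    (hsym : HasRelativeTB (G := ElemSym 2 (MvPolynomial (Fin k) ℤ)) 𝕜 B (normalFactor _)) :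
    HasRelativeFFB (G := SLSym 3 (MvPolynomial (Fin k) ℤ)) 𝕜 B
      (normalFactor _ : Subgroup (SLSym 3 (MvPolynomial (Fin k) ℤ))) :=
  hasRelativeFFB_of_hasRelativeTB hvec hsym
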